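/- All graphs are finite and simple. Let $G$ be a graph. Colour the vertices of a set $S\subseteq V(G)$ and, in each step, let every coloured vertex that has exactly one non-coloured neighbour force that neighbour to become coloured; $S$ is a \emph{forcing set} if eventually all vertices of $G$ are coloured. The \emph{forcing number} $F(G)$ is the minimum cardinality of a forcing set of $G$, and an \emph{$F(G)$-set} is a forcing set of cardinality $F(G)$. For $k\ge 1$, a \emph{standard drawing} of $G$ with $k$ parallel paths consists of $k$ non-empty, pairwise vertex-disjoint induced paths of $G$ that together cover $V(G)$ (the \emph{parallel paths} of the drawing) and of a drawing of $G$ in the plane such that the paths lie on $k$ distinct horizontal lines, the vertices of each path occurring on its line in the order of the path; every edge with ends in different paths is drawn as a straight segment that contains no vertex other than its two ends; and no two of these segments have a point in common other than a common end. (Such a segment may cross the line of a third path.) The graph $G$ is a \emph{graph of $k$-parallel paths} if it has a standard drawing with $k$ parallel paths and is not a graph of $j$-parallel paths for any $1\le j<k$, i.e. it has no standard drawing with fewer than $k$ parallel paths. \textbf{Theorem.} Let $G$ be a graph with maximum degree $\Delta(G)\le 3$. Then $F(G)=3$ if and only if $G$ is a graph of $3$-parallel paths. Moreover, if $G$ is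 a graph of $3$-parallel paths, then in every standard drawing of $G$ with three parallel paths the left-most vertices of the three parallel paths form an $F(G)$-set. -/

import Mathlib

namespace ZeroForcing

variable {V : Type*}

/-- One (synchronous) step of the forcing process: every coloured vertex `u` with exactly one
non-coloured neighbour `v` forces `v` to become coloured. -/
def forceStep (G : SimpleGraph V) (S : Set V) : Set V :=
  S ∪ {v | ∃ u ∈ S, {w | G.Adj u w ∧ w ∉ S} = {v}}

/-- The set of vertices that are coloured at the end of the forcing process started at `S`. -/
def derivedSet (G : SimpleGraph V) (S : Set V) : Set V :=
  ⋃ n : ℕ, (forceStep G)^[n] S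

/-- `S` is a (zero) forcing set of `G`. -/
def IsForcingSet (G : SimpleGraph V) (S : Set V) : Prop :=
  derivedSet G S = Set.univ

/-- The forcing number `F(G)` of a finite graph: the minimum cardinality of a forcing set
(the whole vertex set is always one). -/
noncomputable def forcingNumber [Finite V] (G : SimpleGraph V) : ℕ :=
  sInf {n | ∃ S : Set V, IsForcingSet G S ∧ S.ncard = n}

/-- An `F(G)`-set: a forcing set of cardinality `F(G)`. -/
def IsMinForcingSet [Finite V] (G : SimpleGraph V) (S : Set V) : Prop :=
  IsForcingSet G S ∧ S.ncard = forcingNumber G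

/-- A standard drawing of `G` with `k` parallel paths. The edges inside a path are the horizontal
segments between consecutive vertices of the path; every other edge is drawn as the straight
segment between its two ends. -/
structure StandardDrawing (G : SimpleGraph V) (k : ℕ) where
  /-- The number of edges of the `i`-th path. -/
  len : Fin k → ℕ
  /-- The `k` paths, each listed from left to right. An embedding of graphs reflects adjacency,
  so these are induced paths. -/
  path : ∀ i : Fin k, SimpleGraph.pathGraph (len i + 1) ↪g G
  /-- The paths are vertex disjoint and cover all the vertices. -/
  bijective : Function.Bijective
    (fun p : (Σ i : Fin k, Fin (len i + 1)) => path p.1 p.2)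
  /-- The positions of the vertices in the plane. -/
  pos : V → ℝ × ℝ
  /-- The height of the horizontal line that carries the `i`-th path. -/
  height : Fin k → ℝ
  /-- The `k` parallel lines are distinct. -/
  height_injective : Function.Injective height
  pos_snd : ∀ i j, (pos (path i j)).2 = height i
  /-- The vertices of a path occur on its line in the order in which the path visits them. -/
  pos_fst_strictMono : ∀ i, StrictMono (fun j => (pos (path i j)).1)
  /-- A segment between different paths contains no vertex other than its two ends. -/
  segment_vertex : ∀ u v, G.Adj u v → (pos u).2 ≠ (pos v).2 →
    ∀ w, pos w ∈ segment ℝ (pos u) (pos v) → w = u ∨ w = v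
  /-- Two distinct segments between different paths do not cross. -/
  segment_disjoint : ∀ u v u' v', G.Adj u v → (pos u).2 ≠ (pos v).2 →
    G.Adj u' v' → (pos u').2 ≠ (pos v').2 → s(u, v) ≠ s(u', v') →
    Disjoint (openSegment ℝ (pos u) (pos v)) (openSegment ℝ (pos u') (pos v'))

/-- The set of the left-most vertices of the parallel paths of a standard drawing. -/
def StandardDrawing.leftmost {G : SimpleGraph V} {k : ℕ} (D : StandardDrawing G k) : Set V :=
  {v | ∃ i, v ∈ Set.range (D.path i) ∧
    ∀ w ∈ Set.range (D.path i), (D.pos v).1 ≤ (D.pos w).1}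

/-- `G` is a graph of `k`-parallel paths: it has a standard drawing with `k` parallel paths and it
is not a graph of `j`-parallel paths for any smaller `j`, that is, it has no standard drawing with
fewer parallel paths. -/
def IsGraphOfParallelPaths (G : SimpleGraph V) (k : ℕ) : Prop :=
  Nonempty (StandardDrawing G k) ∧ ∀ j < k, IsEmpty (StandardDrawing G j)

end ZeroForcing

namespace ZeroForcing

variable {V : Type*}

/-! ### The forcing process -/

/-! Both directions come from a translation, valid up to three, between forcing sets and standard
drawings; comparing minima then gives the theorem.

From drawings to forcing sets (`StandardDrawing.isForcingSet_leftmost`, for any degrees): if the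
process stalls, the last vertex before the first gap of each unfinished path is blocked by a
neighbour beyond the first gap of another unfinished path. Following the blocking paths gives a
cycle of length two or three, and both kinds force two edges to cross (`not_interlaced`,
`not_cyclic`).

From forcing sets to drawings (`IsForcingSet.nonempty_standardDrawing`): the forces split the
vertices into chains, which are induced paths. A vertex followed by `w` in its chain has all its
neighbours in other chains coloured before `w`, so edges between the same two chains are never
interlaced when each chain is ordered by time. With three chains, what remains is to control the
edges between the outer chains, which cross the middle line. This is where the degree bound enters:
a suitable chain, closed under forcing, has no vertex with neighbours on both sides of such an edge
(`exists_isUnseparated`). Put in the middle at height 0, with the outer chains at heights 1 and -1,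
it is crossed by long edges at midpoints of abscissas. Exponential coordinates make the side of a
midpoint depend only on a comparison of times, and `delayedTime` moves middle vertices far enough
right to stay on the correct side. -/

lemma subset_forceStep (G : SimpleGraph V) (S : Set V) : S ⊆ forceStep G S :=
  Set.subset_union_left

lemma monotone_iterate_forceStep (G : SimpleGraph V) (S : Set V) :
    Monotone fun n : ℕ => (forceStep G)^[n] S := by
  refine monotone_nat_of_le_succ fun n => ?_
  rw [Function.iterate_succ_apply']
  exact subset_forceStep G _

lemma subset_derivedSet (G : SimpleGraph V) (S : Set V) : S ⊆ derivedSet G S :=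
  Set.subset_iUnion (fun n : ℕ => (forceStep G)^[n] S) 0

lemma isForcingSet_univ (G : SimpleGraph V) : IsForcingSet G Set.univ :=
  Set.eq_univ_of_univ_subset (subset_derivedSet G _)

/-- Finiteness makes the increasing sequence of colourings stabilise, so the final colouring is
closed under forcing. -/
lemma forceStep_derivedSet [Finite V] (G : SimpleGraph V) (S : Set V) :
    forceStep G (derivedSet G S) ⊆ derivedSet G S := by
  obtain ⟨N, hN⟩ := WellFoundedGT.monotone_chain_condition
    ⟨fun n : ℕ => (forceStep G)^[n] S, monotone_iterate_forceStep G S⟩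
  have hD : derivedSet G S = (forceStep G)^[N] S := by
    refine Set.Subset.antisymm (Set.iUnion_subset fun n => ?_)
      (Set.subset_iUnion (fun n : ℕ => (forceStep G)^[n] S) N)
    rcases le_total N n with h | h
    · exact (hN n h).ge
    · exact monotone_iterate_forceStep G S h
  have h1 := hN (N + 1) (Nat.le_succ N)
  simp only [OrderHom.coe_mk, Function.iterate_succ_apply'] at h1
  rw [hD]
  exact h1.ge

/-- A coloured vertex with a non-coloured neighbour has a second one at the end of the process. -/
lemma exists_other_not_mem_derivedSet [Finite V] {G : SimpleGraph V} {S : Set V} {u v : V}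
    (hu : u ∈ derivedSet G S) (huv : G.Adj u v) (hv : v ∉ derivedSet G S) :
    ∃ w, G.Adj u w ∧ w ∉ derivedSet G S ∧ w ≠ v := by
  by_contra! h
  refine hv (forceStep_derivedSet G S (Or.inr ⟨u, hu, ?_⟩))
  ext w
  constructor
  · rintro ⟨h1, h2⟩
    exact h w h1 h2
  · rintro rfl
    exact ⟨huv, hv⟩

lemma forcingNumber_le [Finite V] {G : SimpleGraph V} {S : Set V} (hS : IsForcingSet G S) :
    forcingNumber G ≤ S.ncard :=
  Nat.sInf_le ⟨S, hS, rfl⟩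

lemma exists_isMinForcingSet [Finite V] (G : SimpleGraph V) : ∃ S, IsMinForcingSet G S :=
  Nat.sInf_mem (s := {n | ∃ S : Set V, IsForcingSet G S ∧ S.ncard = n})
    ⟨_, Set.univ, isForcingSet_univ G, rfl⟩

/-! ### The left-most vertices of a standard drawing form a forcing set -/

/-- Two segments between the same two horizontal lines whose ends are interlaced cross. -/
lemma not_disjoint_openSegment_of_interlaced {a b a' b' : ℝ × ℝ} (ha : a.2 = a'.2)
    (hb : b.2 = b'.2) (h1 : a.1 < a'.1) (h2 : b'.1 < b.1) :
    ¬ Disjoint (openSegment ℝ a b) (openSegment ℝ a' b') := by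
  -- The horizontal offsets at the two ends have opposite signs; weighting each end by the size of
  -- the offset at the other end makes them cancel.
  have hpos : 0 < (a'.1 - a.1) + (b.1 - b'.1) := by linarith
  set D := (a'.1 - a.1) + (b.1 - b'.1) with hD
  have hsum : (b.1 - b'.1) / D + (a'.1 - a.1) / D = 1 := by
    rw [← add_div, div_eq_one_iff_eq hpos.ne']; rw [hD]; ring
  have hs : 0 < (b.1 - b'.1) / D := div_pos (by linarith) hpos
  have ht : 0 < (a'.1 - a.1) / D := div_pos (by linarith) hpos
  refine Set.not_disjoint_iff.2 ⟨_, ⟨_, _, hs, ht, hsum, rfl⟩, ⟨_, _, hs, ht, hsum, ?_⟩⟩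
  ext
  · simp only [Prod.fst_add, Prod.smul_fst, smul_eq_mul]
    field_simp
    ring
  · simp only [Prod.snd_add, Prod.smul_snd, smul_eq_mul, ha, hb]

lemma openSegment_subset_openSegment_left {a b z : ℝ × ℝ} (hz : z ∈ openSegment ℝ a b) :
    openSegment ℝ a z ⊆ openSegment ℝ a b := by
  obtain ⟨s, t, hs, ht, hst, rfl⟩ := hz
  rintro _ ⟨α, β, hα, hβ, hαβ, rfl⟩
  refine ⟨α + β * s, β * t, by positivity, by positivity, ?_, ?_⟩
  · rw [add_assoc, ← mul_add, hst, mul_one, hαβ]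
  · rw [smul_add, smul_smul, smul_smul, add_smul, add_assoc]

/-- The point at height `y` of the segment between two points at different heights. -/
lemma exists_mem_openSegment_snd_eq {a b : ℝ × ℝ} {y : ℝ} (h1 : a.2 < y) (h2 : y < b.2) :
    ∃ x, openSegment ℝ a (x, y) ⊆ openSegment ℝ a b ∧ openSegment ℝ (x, y) b ⊆ openSegment ℝ a b := by
  have hpos : 0 < b.2 - a.2 := by linarith
  have hs : 0 < (b.2 - y) / (b.2 - a.2) := div_pos (by linarith) hpos
  have ht : 0 < (y - a.2) / (b.2 - a.2) := div_pos (by linarith) hpos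
  have hsum : (b.2 - y) / (b.2 - a.2) + (y - a.2) / (b.2 - a.2) = 1 := by
    rw [← add_div, div_eq_one_iff_eq hpos.ne']; ring
  set s := (b.2 - y) / (b.2 - a.2)
  set t := (y - a.2) / (b.2 - a.2) with ht'
  have hmem : (s * a.1 + t * b.1, y) ∈ openSegment ℝ a b := by
    refine ⟨s, t, hs, ht, hsum, ?_⟩
    ext
    · simp
    · simp only [Prod.snd_add, Prod.smul_snd, smul_eq_mul]
      have : t * (b.2 - a.2) = y - a.2 := by rw [ht']; field_simp
      have hs1 : s = 1 - t := by linarith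
      rw [hs1]; linarith
  refine ⟨_, openSegment_subset_openSegment_left hmem, ?_⟩
  rw [openSegment_symm] at hmem
  rw [openSegment_symm, openSegment_symm ℝ a b]
  exact openSegment_subset_openSegment_left hmem

namespace StandardDrawing

variable {G : SimpleGraph V} {k : ℕ} (D : StandardDrawing G k)

lemma not_interlaced {u v u' v' : V} (huv : G.Adj u v) (huv' : G.Adj u' v')
    (hu : (D.pos u).2 = (D.pos u').2) (hv : (D.pos v).2 = (D.pos v').2)
    (hne : (D.pos u).2 ≠ (D.pos v).2) (h1 : (D.pos u).1 < (D.pos u').1)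
    (h2 : (D.pos v').1 < (D.pos v).1) : False := by
  refine not_disjoint_openSegment_of_interlaced hu hv h1 h2
    (D.segment_disjoint u v u' v' huv hne huv' (by rwa [← hu, ← hv]) ?_)
  intro h
  rcases Sym2.eq_iff.1 h with ⟨rfl, rfl⟩ | ⟨rfl, rfl⟩
  · exact h1.ne rfl
  · exact hne hv.symm

/-- Three edges cannot join three vertices, one on each of three lines, cyclically to vertices
further to the right. The line of `q` is the middle one. -/
lemma not_cyclic_of_between {p q r p' q' r' : V} (hpq : G.Adj p q') (hqr : G.Adj q r')
    (hrp : G.Adj r p') (hp : (D.pos p).2 = (D.pos p').2) (hq : (D.pos q).2 = (D.pos q').2)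
    (hr : (D.pos r).2 = (D.pos r').2)
    (hbetween : (D.pos p).2 < (D.pos q).2 ∧ (D.pos q).2 < (D.pos r).2 ∨
      (D.pos r).2 < (D.pos q).2 ∧ (D.pos q).2 < (D.pos p).2)
    (hp' : (D.pos p).1 < (D.pos p').1) (hq' : (D.pos q).1 < (D.pos q').1)
    (hr' : (D.pos r).1 < (D.pos r').1) : False := by
  -- `x` is where the edge `r p'` meets the middle line. Its part towards `p'` must not cross `p
  -- q'`, and its part towards `r` must not cross `q r'`; hence `q'` is not to the right of `x`, nor
  -- `x` to the right of `q`.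
  obtain ⟨x, hx1, hx2⟩ : ∃ x,
      openSegment ℝ (D.pos p') (x, (D.pos q).2) ⊆ openSegment ℝ (D.pos r) (D.pos p') ∧
      openSegment ℝ (x, (D.pos q).2) (D.pos r) ⊆ openSegment ℝ (D.pos r) (D.pos p') := by
    rw [hp] at hbetween
    rcases hbetween with ⟨h1, h2⟩ | ⟨h1, h2⟩
    · rw [openSegment_symm ℝ (D.pos r)]
      exact exists_mem_openSegment_snd_eq h1 h2
    · obtain ⟨x, hx1, hx2⟩ := exists_mem_openSegment_snd_eq h1 h2
      exact ⟨x, by rwa [openSegment_symm], by rwa [openSegment_symm]⟩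
  have hpq2 : (D.pos p).2 ≠ (D.pos q).2 := by
    rcases hbetween with h | h <;> [exact h.1.ne; exact h.2.ne']
  have hqr2 : (D.pos q).2 ≠ (D.pos r).2 := by
    rcases hbetween with h | h <;> [exact h.2.ne; exact h.1.ne']
  have hpr2 : (D.pos r).2 ≠ (D.pos p).2 := by
    rcases hbetween with h | h <;> [exact (h.1.trans h.2).ne'; exact (h.1.trans h.2).ne]
  have key1 : (D.pos q').1 ≤ x := by
    by_contra! h
    refine not_disjoint_openSegment_of_interlaced (a := D.pos p) (b := D.pos q')
      (a' := D.pos p') (b' := (x, (D.pos q).2)) hp hq.symm hp' h ?_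
    refine Set.disjoint_of_subset_right hx1 ?_
    refine D.segment_disjoint _ _ _ _ hpq (by rwa [← hq]) hrp (by rwa [← hp]) ?_
    intro h
    rcases Sym2.eq_iff.1 h with ⟨rfl, rfl⟩ | ⟨rfl, rfl⟩
    · exact hpr2 rfl
    · exact hp'.ne rfl
  have key2 : x ≤ (D.pos q).1 := by
    by_contra! h
    refine not_disjoint_openSegment_of_interlaced (a := D.pos q) (b := D.pos r')
      (a' := (x, (D.pos q).2)) (b' := D.pos r) rfl hr.symm h hr' ?_
    refine Set.disjoint_of_subset_right hx2 ?_
    refine D.segment_disjoint _ _ _ _ hqr (by rwa [← hr]) hrp (by rwa [← hp]) ?_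
    intro h
    rcases Sym2.eq_iff.1 h with ⟨rfl, rfl⟩ | ⟨rfl, rfl⟩
    · exact hqr2 rfl
    · exact hr'.ne rfl
  linarith

/-- The configuration is invariant under rotation, so the middle one of the three lines may be taken
to be that of `q`. -/
lemma not_cyclic {p q r p' q' r' : V} (hpq : G.Adj p q') (hqr : G.Adj q r')
    (hrp : G.Adj r p') (hp : (D.pos p).2 = (D.pos p').2) (hq : (D.pos q).2 = (D.pos q').2)
    (hr : (D.pos r).2 = (D.pos r').2) (hpq2 : (D.pos p).2 ≠ (D.pos q).2)
    (hqr2 : (D.pos q).2 ≠ (D.pos r).2) (hrp2 : (D.pos r).2 ≠ (D.pos p).2)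
    (hp' : (D.pos p).1 < (D.pos p').1) (hq' : (D.pos q).1 < (D.pos q').1)
    (hr' : (D.pos r).1 < (D.pos r').1) : False := by
  have h1 := D.not_cyclic_of_between hpq hqr hrp hp hq hr
  have h2 := D.not_cyclic_of_between hqr hrp hpq hq hr hp
  have h3 := D.not_cyclic_of_between hrp hpq hqr hr hp hq
  grind

lemma exists_eq_path (v : V) : ∃ i j, D.path i j = v := by
  obtain ⟨⟨i, j⟩, h⟩ := D.bijective.2 v
  exact ⟨i, j, h⟩

lemma path_zero_mem_leftmost (i : Fin k) : D.path i 0 ∈ D.leftmost := by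
  refine ⟨i, ⟨0, rfl⟩, ?_⟩
  rintro _ ⟨j, rfl⟩
  exact (D.pos_fst_strictMono i).monotone (Fin.zero_le j)

lemma leftmost_eq_range : D.leftmost = Set.range fun i => D.path i 0 := by
  refine Set.Subset.antisymm ?_ (Set.range_subset_iff.2 D.path_zero_mem_leftmost)
  rintro _ ⟨i, ⟨j, rfl⟩, h⟩
  refine ⟨i, congrArg _ (le_antisymm (Fin.zero_le j) ?_)⟩
  exact (D.pos_fst_strictMono i).le_iff_le.1 (h _ ⟨0, rfl⟩)

lemma ncard_leftmost : D.leftmost.ncard = k := by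
  rw [leftmost_eq_range, ← Set.image_univ, Set.ncard_image_of_injective, Set.ncard_univ,
    Nat.card_eq_fintype_card, Fintype.card_fin]
  intro i j h
  have := D.bijective.1 (a₁ := ⟨i, 0⟩) (a₂ := ⟨j, 0⟩) h
  exact congrArg Sigma.fst this

/-- The left-most vertices of a standard drawing with at most three paths form a forcing set: if
the process stops early, then on every path that is not coloured completely the last vertex before
the first gap is blocked by a vertex beyond the first gap of another such path, and following these
paths gives a cycle of length two or three. -/
lemma isForcingSet_leftmost [Finite V] (hk : k ≤ 3) : IsForcingSet G D.leftmost := by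
  set C := derivedSet G D.leftmost with hC
  have h0 : ∀ i, D.path i 0 ∈ C := fun i =>
    subset_derivedSet G _ (D.path_zero_mem_leftmost i)
  let U : Set (Fin k) := {i | ∃ j, D.path i j ∉ C}
  have hfront : ∀ i ∈ U, ∃ j j', D.path i j ∈ C ∧ D.path i j' ∉ C ∧ j.val + 1 = j'.val ∧
      ∀ l ≤ j, D.path i l ∈ C := by
    intro i hi
    obtain ⟨j', hj', hmin⟩ := WellFounded.has_min (r := ((· < ·) : Fin (D.len i + 1) → _ → Prop))
      wellFounded_lt {j | D.path i j ∉ C} hi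
    have hlt : ∀ l < j', D.path i l ∈ C := fun l hl => by
      by_contra h
      exact hmin l h hl
    have hpos : 0 < j'.val := by
      rcases Nat.eq_zero_or_pos j'.val with h | h
      · exact absurd (h0 i) (by rwa [show (0 : Fin (D.len i + 1)) = j' from Fin.ext h.symm])
      · exact h
    refine ⟨⟨j'.val - 1, by omega⟩, j', hlt _ ?_, hj', by simp; omega, fun l hl => hlt l ?_⟩
    · rw [Fin.lt_def]; exact Nat.sub_lt hpos one_pos
    · rw [Fin.lt_def]
      rw [Fin.le_def] at hl
      simp only at hl
      omega
  choose! a b ha hb hab hpre using hfront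
  have hblock : ∀ i ∈ U, ∃ i' ∈ U, i' ≠ i ∧ ∃ w, G.Adj (D.path i (a i)) w ∧
      (D.pos w).2 = D.height i' ∧ (D.pos (D.path i' (a i'))).1 < (D.pos w).1 := by
    intro i hi
    have hadj : G.Adj (D.path i (a i)) (D.path i (b i)) :=
      (D.path i).map_adj_iff.2 (SimpleGraph.pathGraph_adj.2 (Or.inl (hab i hi)))
    obtain ⟨w, hw, hwC, hwb⟩ := exists_other_not_mem_derivedSet (ha i hi) hadj (hb i hi)
    obtain ⟨i', l, rfl⟩ := D.exists_eq_path w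
    have hi' : i' ∈ U := ⟨l, hwC⟩
    have hlt : a i' < l := by
      by_contra! h
      exact hwC (hpre i' hi' l h)
    refine ⟨i', hi', ?_, _, hw, D.pos_snd _ _, D.pos_fst_strictMono i' hlt⟩
    rintro rfl
    rcases SimpleGraph.pathGraph_adj.1 ((D.path i').map_adj_iff.1 hw) with h | h
    · exact hwb (congrArg _ (Fin.ext (h.symm.trans (hab i' hi))))
    · rw [Fin.lt_def] at hlt; omega
  choose! σ hσU hσne w hw hw2 hw1 using hblock
  have hh : ∀ i j, i ≠ j → ∀ x y, (D.pos (D.path i x)).2 ≠ (D.pos (D.path j y)).2 := by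
    intro i j hij x y h
    rw [D.pos_snd, D.pos_snd] at h
    exact hij (D.height_injective h)
  have htwo : ∀ i ∈ U, σ (σ i) ≠ i := by
    intro i hi h
    have hj := hσU i hi
    refine D.not_interlaced (hw i hi) (hw _ hj).symm ?_ ?_ ?_ ?_ (hw1 i hi)
    · rw [hw2 _ hj, h, D.pos_snd]
    · rw [hw2 _ hi, D.pos_snd]
    · rw [hw2 _ hi, D.pos_snd]
      exact fun h' => hσne i hi (D.height_injective h').symm
    · have := hw1 _ hj
      rwa [h] at this
  refine Set.eq_univ_of_forall fun v => ?_
  by_contra hv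
  obtain ⟨i, l, rfl⟩ := D.exists_eq_path v
  have hi : i ∈ U := ⟨l, hv⟩
  have hj := hσU i hi
  have hl := hσU _ hj
  -- The indices `i`, `σ i` and `σ (σ i)` are distinct, hence are all the indices, and only `i` is
  -- left for the third iterate.
  have hcyc : σ (σ (σ i)) = i := by
    have h1 := hσne i hi
    have h2 := hσne _ hj
    have h3 := hσne _ hl
    have h4 := htwo i hi
    have h5 := htwo _ hj
    omega
  have hw1' := hw1 _ hl
  have hw2' := hw2 _ hl
  rw [hcyc] at hw1' hw2'
  refine D.not_cyclic (hw i hi) (hw _ hj) (hw _ hl) ?_ ?_ ?_ (hh _ _ (hσne _ hi).symm _ _)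
    (hh _ _ (hσne _ hj).symm _ _) (hh _ _ (htwo _ hi) _ _) hw1' (hw1 _ hi) (hw1 _ hj)
  · rw [hw2', D.pos_snd]
  · rw [hw2 _ hi, D.pos_snd]
  · rw [hw2 _ hj, D.pos_snd]

lemma forcingNumber_le [Finite V] (D : StandardDrawing G k) (hk : k ≤ 3) : forcingNumber G ≤ k := by
  have := ZeroForcing.forcingNumber_le (D.isForcingSet_leftmost hk)
  rwa [D.ncard_leftmost] at this

end StandardDrawing

/-! ### Forcing chains -/

/-- With respect to the colouring times `τ`, the vertex `u` is able to force `w`: it is coloured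
before `w`, and so are all its other neighbours. -/
def Forces (G : SimpleGraph V) (τ : V → ℕ) (u w : V) : Prop :=
  G.Adj u w ∧ τ u < τ w ∧ ∀ x, G.Adj u x → x ≠ w → τ x < τ w

lemma Forces.unique {G : SimpleGraph V} {τ : V → ℕ} {u w w' : V} (h : Forces G τ u w)
    (h' : Forces G τ u w') : w = w' := by
  by_contra hne
  exact lt_asymm (h.2.2 w' h'.1 (Ne.symm hne)) (h'.2.2 w h.1 hne)

/-- The colouring times of the forcing process started at a forcing set. -/
lemma IsForcingSet.exists_time {G : SimpleGraph V} {S : Set V} (hS : IsForcingSet G S) :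
    ∃ τ : V → ℕ, (∀ v, τ v = 0 ↔ v ∈ S) ∧ ∀ w, τ w ≠ 0 → ∃ u, Forces G τ u w := by
  classical
  have hex : ∀ v, ∃ n : ℕ, v ∈ (forceStep G)^[n] S := fun v => by
    have : v ∈ derivedSet G S := hS ▸ Set.mem_univ v
    simpa [derivedSet] using this
  have hmono : Monotone fun n : ℕ => (forceStep G)^[n] S := 
    monotone_iterate_forceStep G S
  have hle : ∀ v n, Nat.find (hex v) ≤ n ↔ v ∈ (forceStep G)^[n] S := fun v n =>
    ⟨fun h => hmono h (Nat.find_spec (hex v)), fun h => Nat.find_min' (hex v) h⟩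
  refine ⟨fun v => Nat.find (hex v), fun v => by simp, fun w hw => ?_⟩
  obtain ⟨n, hn⟩ := Nat.exists_eq_succ_of_ne_zero hw
  have h1 : w ∈ (forceStep G)^[n + 1] S := (hle w (n + 1)).1 hn.le
  have h2 : w ∉ (forceStep G)^[n] S := fun h => by
    exact absurd (hn ▸ (hle w n).2 h) (Nat.not_succ_le_self n)
  rw [Function.iterate_succ_apply'] at h1
  rcases h1 with h1 | ⟨u, hu, huw⟩
  · exact absurd h1 h2
  have hw' : w ∈ {x | G.Adj u x ∧ x ∉ (forceStep G)^[n] S} := huw ▸ Set.mem_singleton w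
  refine ⟨u, hw'.1, ?_, fun x hx hxw => ?_⟩
  · have := (hle u n).2 hu
    simp only [hn]; omega
  · have : x ∈ (forceStep G)^[n] S := by
      by_contra h
      have : x ∈ ({w} : Set V) := huw ▸ ⟨hx, h⟩
      exact hxw this
    have := (hle x n).2 this
    simp only [hn]; omega

/-- The fibres of `c` are chains: in each of them every vertex but the last one forces the next. -/
structure IsChainPartition {ι : Type*} (G : SimpleGraph V) (τ : V → ℕ) (c : V → ι) : Prop where
  eq_of_time_eq : ∀ u w, c u = c w → τ u = τ w → u = w
  exists_next : ∀ u w, c u = c w → τ u < τ w → ∃ u', c u' = c u ∧ Forces G τ u u' ∧ τ u' ≤ τ w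

/-- If `u` is not the last vertex of its chain, then its neighbours in other chains are coloured
before the later vertices of the chain. -/
lemma IsChainPartition.time_lt {ι : Type*} {G : SimpleGraph V} {τ : V → ℕ} {c : V → ι}
    (h : IsChainPartition G τ c) {u w x : V} (huw : c u = c w) (hlt : τ u < τ w)
    (hx : G.Adj u x) (hxu : c x ≠ c u) : τ x < τ w := by
  obtain ⟨u', h1, h2, h3⟩ := h.exists_next u w huw hlt
  refine (h2.2.2 x hx ?_).trans_le h3
  rintro rfl
  exact hxu h1

/-- Labels of the start vertices spread along the forces `p w → w`. -/
lemma exists_label {ι : Type*} (τ : V → ℕ) (p : V → V) (hp : ∀ w, τ w ≠ 0 → τ (p w) < τ w)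
    (r : V → ι) : ∃ c : V → ι, (∀ w, τ w = 0 → c w = r w) ∧ ∀ w, τ w ≠ 0 → c w = c (p w) := by
  classical
  have wf : WellFounded fun u w => τ u < τ w := (measure τ).wf
  refine ⟨wf.fix fun w ih => if h : τ (p w) < τ w then ih (p w) h else r w, fun w hw => ?_,
    fun w hw => ?_⟩
  · rw [wf.fix_eq, dif_neg (by omega)]
  · rw [wf.fix_eq, dif_pos (hp w hw)]

/-- Two vertices with the same label are compared through their predecessors. Since a vertex forces
at most one vertex, a chain cannot branch. -/
lemma isChainPartition_of_label {ι : Type*} {G : SimpleGraph V} {τ : V → ℕ} {p : V → V}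
    (hp : ∀ w, τ w ≠ 0 → Forces G τ (p w) w) {c : V → ι}
    (h0 : ∀ u w, τ u = 0 → τ w = 0 → c u = c w → u = w)
    (hc : ∀ w, τ w ≠ 0 → c w = c (p w)) : IsChainPartition G τ c := by
  have key : ∀ n, ∀ u w, τ w ≤ n → c u = c w → τ u ≤ τ w →
      u = w ∨ ∃ u', c u' = c u ∧ Forces G τ u u' ∧ τ u' ≤ τ w := by
    intro n
    induction n with
    | zero => exact fun u w hw hcuw huw => Or.inl (h0 u w (by omega) (by omega) hcuw)
    | succ n ih =>
      intro u w hw hcuw huw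
      by_cases hw0 : τ w = 0
      · exact Or.inl (h0 u w (by omega) hw0 hcuw)
      have hq := hp w hw0
      have hcq := hc w hw0
      by_cases hu : τ u ≤ τ (p w)
      · rcases ih u (p w) (by have := hq.2.1; omega) (hcuw.trans hcq) hu with h | ⟨u', h1, h2, h3⟩
        · exact Or.inr ⟨w, hcuw.symm, h ▸ hq, le_rfl⟩
        · exact Or.inr ⟨u', h1, h2, h3.trans hq.2.1.le⟩
      push Not at hu
      have hu0 : τ u ≠ 0 := by omega
      have hq' := hp u hu0
      have hcq' := hc u hu0
      rcases le_total (τ (p w)) (τ (p u)) with hle | hle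
      · rcases ih (p w) (p u) (by have := hq'.2.1; omega) (by rw [← hcq, ← hcq', hcuw]) hle
          with h | ⟨u', h1, h2, h3⟩
        · exact Or.inl (hq'.unique (h ▸ hq))
        · have := h2.unique hq
          subst this
          have := hq'.2.1
          omega
      · rcases ih (p u) (p w) (by have := hq.2.1; omega) (by rw [← hcq, ← hcq', hcuw]) hle
          with h | ⟨u', h1, h2, h3⟩
        · exact Or.inl (hq'.unique (h ▸ hq))
        · have := h2.unique hq'
          subst this
          omega
  refine ⟨fun u w hcuw huw => ?_, fun u w hcuw huw => ?_⟩
  · rcases key _ u w le_rfl hcuw huw.le with h | ⟨u', h1, h2, h3⟩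
    · exact h
    · have := h2.2.1
      omega
  · rcases key _ u w le_rfl hcuw huw.le with h | h
    · exact absurd (h ▸ huw) (lt_irrefl _)
    · exact h

/-- The chains can be chosen such that the chain of a given start vertex `v` cannot be prolonged. -/
lemma exists_isChainPartition {ι : Type*} {G : SimpleGraph V} {τ : V → ℕ}
    (hτ : ∀ w, τ w ≠ 0 → ∃ u, Forces G τ u w) {v : V} (hv : τ v = 0) (r : V → ι)
    (hr : Set.InjOn r {w | τ w = 0}) :
    ∃ c : V → ι, IsChainPartition G τ c ∧ (∀ w, τ w = 0 → c w = r w) ∧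
      (∀ w, τ w ≠ 0 → ∃ u, c u = c w ∧ Forces G τ u w) ∧
      ∀ u w, c u = r v → Forces G τ u w → c w = r v := by
  classical
  let M : Set V := {w | Relation.ReflTransGen (Forces G τ) v w}
  have hex : ∀ w, ∃ u, τ w ≠ 0 → Forces G τ u w ∧ (w ∈ M → u ∈ M) := by
    intro w
    -- A forcing vertex reachable from `v` is preferred, so that the chain of `v` becomes the whole
    -- set `M`, which is closed under forcing.
    by_cases h : ∃ u ∈ M, Forces G τ u w
    · obtain ⟨u, hu, huw⟩ := h
      exact ⟨u, fun _ => ⟨huw, fun _ => hu⟩⟩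
    · by_cases hw : τ w = 0
      · exact ⟨w, fun h => absurd hw h⟩
      · obtain ⟨u, hu⟩ := hτ w hw
        refine ⟨u, fun _ => ⟨hu, fun hwM => ?_⟩⟩
        rcases Relation.ReflTransGen.cases_tail hwM with h1 | ⟨u', h1, h2⟩
        · exact absurd (h1 ▸ hv) hw
        · exact absurd ⟨u', h1, h2⟩ h
  choose p hp using hex
  obtain ⟨c, hc0, hc⟩ := exists_label τ p (fun w hw => (hp w hw).1.2.1) r
  have hM : ∀ n w, τ w ≤ n → (c w = r v ↔ w ∈ M) := by
    intro n
    induction n with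
    | zero =>
      intro w hw
      have hw0 : τ w = 0 := by omega
      rw [hc0 w hw0, hr.eq_iff hw0 hv]
      constructor
      · rintro rfl
        exact Relation.ReflTransGen.refl
      · intro h
        rcases Relation.ReflTransGen.cases_tail h with h1 | ⟨u', h1, h2⟩
        · exact h1
        · have := h2.2.1
          omega
    | succ n ih =>
      intro w hw
      by_cases hw0 : τ w = 0
      · exact ih w (by omega)
      rw [hc w hw0, ih (p w) (by have := (hp w hw0).1.2.1; omega)]
      exact ⟨fun h => h.tail (hp w hw0).1, (hp w hw0).2⟩
  refine ⟨c, isChainPartition_of_label (fun w hw => (hp w hw).1) ?_ hc, hc0,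
    fun w hw => ⟨p w, (hc w hw).symm, (hp w hw).1⟩, fun u w hu huw => ?_⟩
  · intro u w hu hw h
    rw [hc0 u hu, hc0 w hw] at h
    exact hr hu hw h
  · exact (hM _ w le_rfl).2 (((hM _ u le_rfl).1 hu).tail huw)

/-- Some start vertex has at most one neighbour outside the start set. -/
lemma exists_start {G : SimpleGraph V} {τ : V → ℕ} [Nonempty V]
    (hτ : ∀ w, τ w ≠ 0 → ∃ u, Forces G τ u w) :
    ∃ v, τ v = 0 ∧ ∀ x y, G.Adj v x → G.Adj v y → τ x ≠ 0 → τ y ≠ 0 → x = y := by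
  by_cases h : ∃ w, τ w ≠ 0
  · obtain ⟨w, hw, hmin⟩ := WellFounded.has_min (measure τ).wf {w | τ w ≠ 0} h
    obtain ⟨u, hu⟩ := hτ w hw
    have hz : ∀ x, τ x < τ w → τ x = 0 := fun x hx => by
      by_contra h0
      exact hmin x h0 hx
    have hx : ∀ x, G.Adj u x → τ x ≠ 0 → x = w := fun x hx hx0 => by
      by_contra hxw
      exact hx0 (hz x (hu.2.2 x hx hxw))
    exact ⟨u, hz u hu.2.1, fun x y h1 h2 h3 h4 => (hx x h1 h3).trans (hx y h2 h4).symm⟩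
  · push Not at h
    obtain ⟨v⟩ := ‹Nonempty V›
    exact ⟨v, h v, fun x y _ _ hx => absurd (h x) hx⟩

/-- No vertex of the chain `m` has neighbours on both sides of an edge between two other chains. -/
def IsUnseparated {ι : Type*} (G : SimpleGraph V) (τ : V → ℕ) (c : V → ι) (m : ι) : Prop :=
  ∀ a b z x y, G.Adj a b → c a ≠ c b → c a ≠ m → c b ≠ m → c z = m → G.Adj z x → G.Adj z y →
    c x = c a → τ x < τ a → (c y = c a ∧ τ a < τ y ∨ c y = c b ∧ τ b < τ y) → False

/-- In a graph of maximum degree at most three some partition into chains has an unseparated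
chain, and the label of that chain can be prescribed. -/
lemma exists_isUnseparated [Fintype V] [Nonempty V] {G : SimpleGraph V} [DecidableRel G.Adj]
    (hG : G.maxDegree ≤ 3) {τ : V → ℕ} (hτ : ∀ w, τ w ≠ 0 → ∃ u, Forces G τ u w)
    {k : ℕ} (hk : {w | τ w = 0}.ncard = k) (m : Fin k) :
    ∃ c : V → Fin k, IsChainPartition G τ c ∧ Function.Surjective c ∧ IsUnseparated G τ c m := by
  classical
  obtain ⟨v, hv, hv1⟩ := exists_start hτ
  obtain ⟨r, hr, hrs, hrv⟩ : ∃ r : V → Fin k, Set.InjOn r {w | τ w = 0} ∧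
      (∀ i, ∃ w, τ w = 0 ∧ r w = i) ∧ r v = m := by
    have e : {w // τ w = 0} ≃ Fin k := Finite.equivFinOfCardEq hk
    let e' := e.trans (Equiv.swap (e ⟨v, hv⟩) m)
    refine ⟨fun w => if h : τ w = 0 then e' ⟨w, h⟩ else m, ?_, fun i => ?_, ?_⟩
    · intro u hu w hw h
      have hu' : τ u = 0 := hu
      have hw' : τ w = 0 := hw
      simp only [hu', hw', dite_true] at h
      exact congrArg Subtype.val (e'.injective h)
    · refine ⟨e'.symm i, (e'.symm i).2, ?_⟩
      simp [(e'.symm i).2]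
    · simp [hv, e']
  obtain ⟨c, hc, hc0, hcp, hcm⟩ := exists_isChainPartition hτ hv r hr
  refine ⟨c, hc, fun i => ?_, ?_⟩
  · obtain ⟨w, hw, rfl⟩ := hrs i
    exact ⟨w, hc0 w hw⟩
  rw [hrv] at hcm
  intro a b z x y hab hcab ha hb hz hzx hzy hxa hxlt hy
  have hza : τ z < τ a := hc.time_lt hxa hxlt hzx.symm (by rwa [hz, hxa, ne_comm])
  have hay : τ a < τ y := by
    rcases hy with ⟨h1, h2⟩ | ⟨h1, h2⟩
    · exact h2
    · exact hc.time_lt h1.symm h2 hab.symm hcab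
  have hcy : c y ≠ m := by
    rcases hy with ⟨h1, -⟩ | ⟨h1, -⟩ <;> rwa [h1]
  -- If `z` could force `y`, then `y` would lie in the chain `m`, which is closed under forcing. So
  -- some other neighbour `n` of `z` is not coloured before `y`.
  refine hcy (hcm z y hz ⟨hzy, hza.trans hay, fun n hn hny => ?_⟩)
  by_cases hz0 : τ z = 0
  · have hzv : z = v := hr hz0 hv (by rw [← hc0 z hz0, hz, hrv])
    subst hzv
    by_cases hn0 : τ n = 0
    · omega
    · exact absurd (hv1 n y hn hzy hn0 (by omega)) hny
  · obtain ⟨q, hq, hqz⟩ := hcp z hz0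
    have hxy : x ≠ y := by
      rintro rfl
      omega
    by_contra hlt
    have hnx : n ≠ x := by
      rintro rfl
      omega
    have hnq : n ≠ q := by
      rintro rfl
      have := hqz.2.1
      omega
    have hqx : q ≠ x := by
      rintro rfl
      rw [hq, hz] at hxa
      exact ha hxa.symm
    have hqy : q ≠ y := by
      rintro rfl
      exact hcy (hq.trans hz)
    -- Here `q` is the predecessor of `z` in its chain; a fourth neighbour contradicts the degree
    -- bound. A start vertex has no predecessor, which is why `v` was chosen with at most one
    -- neighbour outside the start set.
    have hsub : ({n, q, x, y} : Finset V) ⊆ G.neighborFinset z := by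
      intro t ht
      rw [SimpleGraph.mem_neighborFinset]
      simp only [Finset.mem_insert, Finset.mem_singleton] at ht
      rcases ht with rfl | rfl | rfl | rfl
      exacts [hn, hqz.1.symm, hzx, hzy]
    have hcard := Finset.card_le_card hsub
    rw [SimpleGraph.card_neighborFinset_eq_degree] at hcard
    have h4 : ({n, q, x, y} : Finset V).card = 4 := by
      simp [hnq, hnx, hny, hqx, hqy, hxy]
    have := G.degree_le_maxDegree z
    omega

/-! ### Drawing the chains -/

section Abscissa

variable [Fintype V] {ι : Type*}

open Classical in
/-- The time at which a vertex of the middle chain is drawn: not before it is coloured, and at most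
one step before a neighbour in another chain is coloured. -/
noncomputable def delayedTime (G : SimpleGraph V) (τ : V → ℕ) (c : V → ι) (v : V) : ℕ :=
  max (τ v) ((Finset.univ.filter fun n => G.Adj v n ∧ c n ≠ c v).sup fun n => τ n - 1)

open Classical in
/-- The `x`-coordinates of the vertices in a drawing of the chains whose middle chain is `m`. -/
noncomputable def abscissa (G : SimpleGraph V) (τ : V → ℕ) (c : V → ι) (m : ι) (v : V) : ℝ :=
  if c v = m then 2 * 5 ^ delayedTime G τ c v else 5 ^ τ v

variable {G : SimpleGraph V} {τ : V → ℕ} {c : V → ι} {m : ι}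

lemma time_le_delayedTime (v : V) : τ v ≤ delayedTime G τ c v := le_max_left _ _

lemma time_le_delayedTime_add_one {v n : V} (h : G.Adj v n) (hc : c n ≠ c v) :
    τ n ≤ delayedTime G τ c v + 1 := by
  classical
  have h1 : τ n - 1 ≤ (Finset.univ.filter fun n => G.Adj v n ∧ c n ≠ c v).sup fun n => τ n - 1 :=
    Finset.le_sup (f := fun n => τ n - 1) (by simp [h, hc])
  have h2 : τ n - 1 ≤ delayedTime G τ c v := h1.trans (le_max_right _ _)
  omega

lemma delayedTime_lt {v : V} {t : ℕ} (h : τ v < t)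
    (h' : ∀ n, G.Adj v n → c n ≠ c v → τ n ≤ t) : delayedTime G τ c v < t := by
  classical
  refine max_lt h ((Finset.sup_lt_iff (by simp; omega)).2 fun n hn => ?_)
  simp only [Finset.mem_filter, Finset.mem_univ, true_and] at hn
  have := h' n hn.1 hn.2
  omega

/-- The delay does not disturb the order of the middle chain: all outside neighbours of `u` are
coloured before `w`, so the delayed time of `u` is still less than `τ w`. -/
lemma abscissa_lt_abscissa (hc : IsChainPartition G τ c) {u w : V} (huw : c u = c w)
    (hlt : τ u < τ w) : abscissa G τ c m u < abscissa G τ c m w := by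
  unfold abscissa
  rw [huw]
  split_ifs
  · have h1 : delayedTime G τ c u < τ w :=
      delayedTime_lt hlt fun n hn hne => (hc.time_lt huw hlt hn hne).le
    have h2 := h1.trans_le (time_le_delayedTime (G := G) (c := c) w)
    have := pow_lt_pow_right₀ (by norm_num : (1 : ℝ) < 5) h2
    linarith
  · exact pow_lt_pow_right₀ (by norm_num) hlt

lemma abscissa_injOn_fiber (hc : IsChainPartition G τ c) {u w : V} (huw : c u = c w)
    (h : abscissa G τ c m u = abscissa G τ c m w) : u = w := by
  rcases lt_trichotomy (τ u) (τ w) with h1 | h1 | h1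
  · exact absurd h (abscissa_lt_abscissa hc huw h1).ne
  · exact hc.eq_of_time_eq u w huw h1
  · exact absurd h (abscissa_lt_abscissa hc huw.symm h1).ne'

/-- Edges between the same two chains are not interlaced. -/
lemma abscissa_le_abscissa (hc : IsChainPartition G τ c) {u v u' v' : V} (huv : G.Adj u v)
    (huv' : G.Adj u' v') (hu : c u = c u') (hv : c v = c v') (hne : c u ≠ c v)
    (h : τ u < τ u') : abscissa G τ c m v ≤ abscissa G τ c m v' := by
  have hle : τ v ≤ τ v' := by
    by_contra! h'
    have h1 := hc.time_lt hu h huv hne.symm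
    have h2 := hc.time_lt hv.symm h' huv'.symm (by rwa [← hu, ← hv])
    omega
  rcases hle.lt_or_eq with h1 | h1
  · exact (abscissa_lt_abscissa hc hv h1).le
  · rw [hc.eq_of_time_eq v v' hv h1]

/-- The constants 5 and 2 serve this lemma and the next: with `T` the delayed time, `4 * 5 ^ T` is
less than `5 ^ (T + 1)` but more than `2 * 5 ^ T`. Thus the side of the midpoint is decided by
comparing `T` with the later of the two outer times. -/
lemma abscissa_lt_of_delayedTime_lt {a b v : V} (ha : c a ≠ m) (hb : c b ≠ m) (hv : c v = m)
    (h : delayedTime G τ c v < max (τ a) (τ b)) :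
    2 * abscissa G τ c m v < abscissa G τ c m a + abscissa G τ c m b := by
  simp only [abscissa, ha, hb, hv, if_true, if_false]
  have key : ∀ t : ℕ, delayedTime G τ c v < t → 2 * (2 * (5 : ℝ) ^ delayedTime G τ c v) < 5 ^ t := by
    intro t ht
    have h1 : (5 : ℝ) ^ (delayedTime G τ c v + 1) ≤ 5 ^ t :=
      pow_le_pow_right₀ (by norm_num) ht
    have h2 : (0 : ℝ) < 5 ^ delayedTime G τ c v := by positivity
    rw [pow_succ] at h1
    linarith
  have h1 : (0 : ℝ) < 5 ^ τ a := by positivity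
  have h2 : (0 : ℝ) < 5 ^ τ b := by positivity
  rcases lt_max_iff.1 h with h | h <;> have := key _ h <;> linarith

lemma lt_abscissa_of_le_delayedTime {a b v : V} (ha : c a ≠ m) (hb : c b ≠ m) (hv : c v = m)
    (h : max (τ a) (τ b) ≤ delayedTime G τ c v) :
    abscissa G τ c m a + abscissa G τ c m b < 2 * abscissa G τ c m v := by
  simp only [abscissa, ha, hb, hv, if_true, if_false]
  have h1 : (5 : ℝ) ^ τ a ≤ 5 ^ delayedTime G τ c v :=
    pow_le_pow_right₀ (by norm_num) ((le_max_left _ _).trans h)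
  have h2 : (5 : ℝ) ^ τ b ≤ 5 ^ delayedTime G τ c v :=
    pow_le_pow_right₀ (by norm_num) ((le_max_right _ _).trans h)
  have h3 : (0 : ℝ) < 5 ^ delayedTime G τ c v := by positivity
  linarith

lemma two_mul_abscissa_ne {a b v : V} (ha : c a ≠ m) (hb : c b ≠ m) (hv : c v = m) :
    2 * abscissa G τ c m v ≠ abscissa G τ c m a + abscissa G τ c m b := by
  rcases lt_or_ge (delayedTime G τ c v) (max (τ a) (τ b)) with h | h
  · exact (abscissa_lt_of_delayedTime_lt ha hb hv h).ne
  · exact (lt_abscissa_of_le_delayedTime ha hb hv h).ne'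

/-- A neighbour in the middle chain of a vertex before `a` lies to the left of the edge `ab`. -/
lemma abscissa_lt_of_lt (hc : IsChainPartition G τ c) (hm : IsUnseparated G τ c m)
    (hthree : ∀ i j l, i ≠ m → j ≠ m → l ≠ m → i ≠ j → l = i ∨ l = j) {a b a' v : V}
    (hab : G.Adj a b) (hcab : c a ≠ c b) (ha : c a ≠ m) (hb : c b ≠ m) (hv : c v = m)
    (hva : G.Adj a' v) (ha' : c a' = c a) (hlt : τ a' < τ a) :
    2 * abscissa G τ c m v < abscissa G τ c m a + abscissa G τ c m b := by
  refine abscissa_lt_of_delayedTime_lt ha hb hv (delayedTime_lt ?_ fun n hn hne => ?_)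
  · exact lt_max_of_lt_left (hc.time_lt ha' hlt hva (by rw [hv, ha']; exact ha.symm))
  · rw [hv] at hne
    -- A neighbour later than both ends would put neighbours of `v` on both sides of `ab`.
    have := hm a b v a' n hab hcab ha hb hv hva.symm hn ha' hlt
    rcases hthree _ _ _ ha hb hne hcab with h | h
    · refine le_max_of_le_left ?_
      by_contra! h'
      exact this (Or.inl ⟨h, h'⟩)
    · refine le_max_of_le_right ?_
      by_contra! h'
      exact this (Or.inr ⟨h, h'⟩)

/-- A neighbour in the middle chain of a vertex after `a` lies to the right of the edge `ab`. -/
lemma lt_abscissa_of_lt (hc : IsChainPartition G τ c) {a b a' v : V}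
    (hab : G.Adj a b) (hcab : c a ≠ c b) (ha : c a ≠ m) (hb : c b ≠ m) (hv : c v = m)
    (hva : G.Adj a' v) (ha' : c a' = c a) (hlt : τ a < τ a') :
    abscissa G τ c m a + abscissa G τ c m b < 2 * abscissa G τ c m v := by
  refine lt_abscissa_of_le_delayedTime ha hb hv ?_
  have h1 := time_le_delayedTime_add_one (τ := τ) (c := c) hva.symm (by rw [hv, ha']; exact ha)
  have h2 := hc.time_lt ha'.symm hlt hab hcab.symm
  exact max_le (by omega) (by omega)

end Abscissa

/-- Two segments between the same two horizontal lines that are not interlaced do not cross. -/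
lemma disjoint_openSegment_of_le {x y x' y' h k : ℝ} (hk : h ≠ k) (hx : x ≤ x') (hy : y ≤ y')
    (hne : x ≠ x' ∨ y ≠ y') :
    Disjoint (openSegment ℝ (x, h) (y, k)) (openSegment ℝ (x', h) (y', k)) := by
  refine Set.disjoint_left.2 ?_
  rintro p ⟨s, t, hs, ht, hst, rfl⟩ ⟨s', t', hs', ht', hst', hp⟩
  simp only [Prod.ext_iff, Prod.fst_add, Prod.snd_add, Prod.smul_fst, Prod.smul_snd,
    smul_eq_mul] at hp
  obtain ⟨h1, h2⟩ := hp
  obtain rfl : s = 1 - t := by linarith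
  obtain rfl : s' = 1 - t' := by linarith
  have htt : t' = t := by
    have : (t' - t) * (k - h) = 0 := by linarith
    rcases mul_eq_zero.1 this with h | h
    · linarith
    · exact absurd (by linarith) hk
  subst htt
  have h3 := mul_le_mul_of_nonneg_left hx hs.le
  have h4 := mul_le_mul_of_nonneg_left hy ht.le
  rcases hne with hne | hne
  · have := mul_lt_mul_of_pos_left (lt_of_le_of_ne hx hne) hs
    linarith
  · have := mul_lt_mul_of_pos_left (lt_of_le_of_ne hy hne) ht
    linarith

/-- A segment from height `h` to height `-h` and one from height `h` to height `0` that lies on one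
side of it do not cross. -/
lemma disjoint_openSegment_of_half {a b a' v h : ℝ} (hh : h ≠ 0)
    (hlr : a' ≤ a ∧ 2 * v < a + b ∨ a ≤ a' ∧ a + b < 2 * v) :
    Disjoint (openSegment ℝ (a, h) (b, -h)) (openSegment ℝ (a', h) (v, 0)) := by
  refine Set.disjoint_left.2 ?_
  rintro p ⟨s, t, hs, ht, hst, rfl⟩ ⟨s', t', hs', ht', hst', hp⟩
  simp only [Prod.ext_iff, Prod.fst_add, Prod.snd_add, Prod.smul_fst, Prod.smul_snd,
    smul_eq_mul] at hp
  obtain ⟨h1, h2⟩ := hp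
  obtain rfl : s' = 1 - t' := by linarith
  obtain rfl : s = 1 - t := by linarith
  have htt : t' = 2 * t := by
    have : (t' - 2 * t) * h = 0 := by linarith
    rcases mul_eq_zero.1 this with h | h
    · linarith
    · exact absurd h hh
  subst htt
  rcases hlr with ⟨h3, h4⟩ | ⟨h3, h4⟩
  · have h5 := mul_le_mul_of_nonneg_left h3 hs'.le
    have h6 := mul_lt_mul_of_pos_left h4 ht
    linarith
  · have h5 := mul_le_mul_of_nonneg_left h3 hs'.le
    have h6 := mul_lt_mul_of_pos_left h4 ht
    linarith

lemma disjoint_openSegment_of_opposite {x y x' y' h : ℝ} (hh : h ≠ 0) :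
    Disjoint (openSegment ℝ (x, h) (y, 0)) (openSegment ℝ (x', -h) (y', 0)) := by
  refine Set.disjoint_left.2 ?_
  rintro p ⟨s, t, hs, ht, hst, rfl⟩ ⟨s', t', hs', ht', hst', hp⟩
  simp only [Prod.ext_iff, Prod.snd_add, Prod.smul_snd, smul_eq_mul] at hp
  have : (s + s') * h = 0 := by linarith [hp.2]
  rcases mul_eq_zero.1 this with h1 | h1
  · linarith
  · exact hh h1

/-! ### Absence of crossings and of vertices on segments -/

section Drawing

variable [Fintype V] {ι : Type*} {G : SimpleGraph V} {τ : V → ℕ} {c : V → ι} {m : ι} {ht : ι → ℝ}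

lemma three_of_height (hinj : Function.Injective ht)
    (hval : ∀ i, ht i = -1 ∨ ht i = 0 ∨ ht i = 1) (hm0 : ht m = 0) (i j l : ι) (hi : i ≠ m)
    (hj : j ≠ m) (hl : l ≠ m) (hij : i ≠ j) : l = i ∨ l = j := by
  have hi' : ht i ≠ 0 := fun h => hi (hinj (h.trans hm0.symm))
  have hj' : ht j ≠ 0 := fun h => hj (hinj (h.trans hm0.symm))
  have hl' : ht l ≠ 0 := fun h => hl (hinj (h.trans hm0.symm))
  have hij' : ht i ≠ ht j := fun h => hij (hinj h)
  have : ht l = ht i ∨ ht l = ht j := by grind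
  exact this.imp (fun h => hinj h) (fun h => hinj h)

lemma segment_vertex_of_chains (hinj : Function.Injective ht)
    (hval : ∀ i, ht i = -1 ∨ ht i = 0 ∨ ht i = 1) (hm0 : ht m = 0)
    (hc : IsChainPartition G τ c) {u v w : V} (hne : c u ≠ c v)
    (hw : (abscissa G τ c m w, ht (c w)) ∈
      segment ℝ (abscissa G τ c m u, ht (c u)) (abscissa G τ c m v, ht (c v))) :
    w = u ∨ w = v := by
  obtain ⟨s, t, hs, ht', hst, hp⟩ := hw
  simp only [Prod.ext_iff, Prod.fst_add, Prod.snd_add, Prod.smul_fst, Prod.smul_snd,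
    smul_eq_mul] at hp
  obtain ⟨h1, h2⟩ := hp
  obtain rfl : s = 1 - t := by linarith
  have hne' : ht (c v) - ht (c u) ≠ 0 := fun h => hne (hinj (by linarith))
  by_cases hwu : c w = c u
  · have ht0 : t = 0 := by
      have : t * (ht (c v) - ht (c u)) = 0 := by rw [hwu] at h2; linarith
      exact (mul_eq_zero.1 this).resolve_right hne'
    subst ht0
    exact Or.inl (abscissa_injOn_fiber (m := m) hc hwu (by linarith))
  by_cases hwv : c w = c v
  · have ht0 : t = 1 := by
      have : (t - 1) * (ht (c v) - ht (c u)) = 0 := by rw [hwv] at h2; linarith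
      have := (mul_eq_zero.1 this).resolve_right hne'
      linarith
    subst ht0
    exact Or.inr (abscissa_injOn_fiber (m := m) hc hwv (by linarith))
  exfalso
  have g1 : ht (c w) ≠ ht (c u) := fun h => hwu (hinj h)
  have g2 : ht (c w) ≠ ht (c v) := fun h => hwv (hinj h)
  -- A vertex on a third line can only meet a segment between the outer lines, and only at its
  -- midpoint.
  have g3 : ht (c w) = 0 ∧ t = 1 / 2 := by
    rcases hval (c u) with e1 | e1 | e1 <;> rcases hval (c v) with e2 | e2 | e2 <;>
      rcases hval (c w) with e3 | e3 | e3 <;> rw [e1, e2, e3] at h2 <;>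
      first
      | exact absurd (e3.trans e1.symm) g1
      | exact absurd (e3.trans e2.symm) g2
      | (refine absurd ?_ hne'; rw [e1, e2]; norm_num; done)
      | (refine ⟨e3, ?_⟩; linarith)
      | (exfalso; linarith)
  have hwm : c w = m := hinj (g3.1.trans hm0.symm)
  refine two_mul_abscissa_ne (G := G) (τ := τ) (c := c) (m := m) (a := u) (b := v) ?_ ?_ hwm ?_
  · rwa [← hwm, ne_comm]
  · rwa [← hwm, ne_comm]
  · rw [g3.2] at h1
    linarith

lemma disjoint_of_same_chains (hinj : Function.Injective ht)
    (hc : IsChainPartition G τ c) {u v u' v' : V} (huv : G.Adj u v) (huv' : G.Adj u' v')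
    (hu : c u = c u') (hv : c v = c v') (hne : c u ≠ c v) (hdiff : s(u, v) ≠ s(u', v')) :
    Disjoint (openSegment ℝ (abscissa G τ c m u, ht (c u)) (abscissa G τ c m v, ht (c v)))
      (openSegment ℝ (abscissa G τ c m u', ht (c u')) (abscissa G τ c m v', ht (c v'))) := by
  rw [← hu, ← hv]
  have hne' : ht (c u) ≠ ht (c v) := fun h => hne (hinj h)
  have hd : abscissa G τ c m u ≠ abscissa G τ c m u' ∨
      abscissa G τ c m v ≠ abscissa G τ c m v' := by
    by_contra! h
    exact hdiff (by rw [abscissa_injOn_fiber hc hu h.1, abscissa_injOn_fiber hc hv h.2])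
  rcases lt_trichotomy (τ u) (τ u') with h | h | h
  · exact disjoint_openSegment_of_le hne' (abscissa_lt_abscissa hc hu h).le
      (abscissa_le_abscissa hc huv huv' hu hv hne h) hd
  · have huu := hc.eq_of_time_eq u u' hu h
    rcases le_total (abscissa G τ c m v) (abscissa G τ c m v') with h' | h'
    · exact disjoint_openSegment_of_le hne' (by rw [huu]) h' hd
    · exact (disjoint_openSegment_of_le hne' (by rw [huu]) h'
        (hd.imp Ne.symm Ne.symm)).symm
  · exact (disjoint_openSegment_of_le hne' (abscissa_lt_abscissa hc hu.symm h).le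
      (abscissa_le_abscissa hc huv' huv hu.symm hv.symm (by rwa [← hu, ← hv]) h)
      (hd.imp Ne.symm Ne.symm)).symm

lemma disjoint_of_long_short (hinj : Function.Injective ht)
    (hval : ∀ i, ht i = -1 ∨ ht i = 0 ∨ ht i = 1) (hm0 : ht m = 0)
    (hc : IsChainPartition G τ c) (hm : IsUnseparated G τ c m) {a b a' v : V}
    (hab : G.Adj a b) (hva : G.Adj a' v) (ha' : c a' = c a) (hb : ht (c b) = -ht (c a))
    (ha0 : ht (c a) ≠ 0) (hv0 : ht (c v) = 0) :
    Disjoint (openSegment ℝ (abscissa G τ c m a, ht (c a)) (abscissa G τ c m b, ht (c b)))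
      (openSegment ℝ (abscissa G τ c m a', ht (c a')) (abscissa G τ c m v, ht (c v))) := by
  have hvm : c v = m := hinj (hv0.trans hm0.symm)
  have ham : c a ≠ m := fun h => ha0 (h ▸ hm0)
  have hbm : c b ≠ m := fun h => by
    rw [h, hm0] at hb
    exact ha0 (by linarith)
  have hcab : c a ≠ c b := fun h => by
    rw [← h] at hb
    exact ha0 (by linarith)
  rw [hv0, hb, ha']
  refine disjoint_openSegment_of_half ha0 ?_
  rcases lt_trichotomy (τ a') (τ a) with h | h | h
  · exact Or.inl ⟨(abscissa_lt_abscissa hc ha' h).le, abscissa_lt_of_lt hc hm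
      (three_of_height hinj hval hm0) hab hcab ham hbm hvm hva ha' h⟩
  · have := hc.eq_of_time_eq a' a ha' h
    rcases (two_mul_abscissa_ne (G := G) (τ := τ) ham hbm hvm).lt_or_gt with h' | h'
    · exact Or.inl ⟨by rw [this], h'⟩
    · exact Or.inr ⟨by rw [this], h'⟩
  · exact Or.inr ⟨(abscissa_lt_abscissa hc ha'.symm h).le,
      lt_abscissa_of_lt hc hab hcab ham hbm hvm hva ha' h⟩

lemma segment_disjoint_of_chains (hinj : Function.Injective ht)
    (hval : ∀ i, ht i = -1 ∨ ht i = 0 ∨ ht i = 1) (hm0 : ht m = 0)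
    (hc : IsChainPartition G τ c) (hm : IsUnseparated G τ c m) {u v u' v' : V}
    (huv : G.Adj u v) (huv' : G.Adj u' v') (hne : ht (c u) ≠ ht (c v))
    (hne' : ht (c u') ≠ ht (c v')) (hdiff : s(u, v) ≠ s(u', v')) :
    Disjoint (openSegment ℝ (abscissa G τ c m u, ht (c u)) (abscissa G τ c m v, ht (c v)))
      (openSegment ℝ (abscissa G τ c m u', ht (c u')) (abscissa G τ c m v', ht (c v'))) := by
  -- Each edge is oriented to run from the top line to the bottom line, or from an outer line to the
  -- middle one; this leaves only long and short edges to compare.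
  have normal : ∀ u v, G.Adj u v → ht (c u) ≠ ht (c v) → ∃ x y, G.Adj x y ∧ s(u, v) = s(x, y) ∧
      openSegment ℝ (abscissa G τ c m u, ht (c u)) (abscissa G τ c m v, ht (c v)) =
        openSegment ℝ (abscissa G τ c m x, ht (c x)) (abscissa G τ c m y, ht (c y)) ∧
      ht (c x) ≠ 0 ∧ (ht (c x) = 1 ∧ ht (c y) = -1 ∨ ht (c y) = 0) := by
    intro u v huv hne
    by_cases h : ht (c v) = 0 ∨ ht (c u) = 1 ∧ ht (c v) = -1
    · exact ⟨u, v, huv, rfl, rfl, by grind, by grind⟩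
    · exact ⟨v, u, huv.symm, Sym2.eq_swap, openSegment_symm _ _ _, by grind, by grind⟩
  obtain ⟨x, y, hxy, he, hseg, hx0, hy⟩ := normal u v huv hne
  obtain ⟨x', y', hxy', he', hseg', hx0', hy'⟩ := normal u' v' huv' hne'
  rw [hseg, hseg']
  rw [he, he'] at hdiff
  rcases hy with ⟨h1, h2⟩ | h2 <;> rcases hy' with ⟨h1', h2'⟩ | h2'
  · exact disjoint_of_same_chains hinj hc hxy hxy' (hinj (h1.trans h1'.symm))
      (hinj (h2.trans h2'.symm)) (fun h => by rw [← h, h1] at h2; norm_num at h2) hdiff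
  · rcases hval (c x') with h1' | h1' | h1'
    · rw [openSegment_symm]
      exact disjoint_of_long_short hinj hval hm0 hc hm hxy.symm hxy' (hinj (h1'.trans h2.symm))
        (by rw [h1, h2]; norm_num) (by rw [h2]; norm_num) h2'
    · exact absurd h1' hx0'
    · exact disjoint_of_long_short hinj hval hm0 hc hm hxy hxy' (hinj (h1'.trans h1.symm))
        (by rw [h1, h2]) hx0 h2'
  · rcases hval (c x) with h1 | h1 | h1
    · rw [openSegment_symm ℝ (abscissa G τ c m x', ht (c x'))]
      exact (disjoint_of_long_short hinj hval hm0 hc hm hxy'.symm hxy (hinj (h1.trans h2'.symm))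
        (by rw [h1', h2']; norm_num) (by rw [h2']; norm_num) h2).symm
    · exact absurd h1 hx0
    · exact (disjoint_of_long_short hinj hval hm0 hc hm hxy' hxy (hinj (h1.trans h1'.symm))
        (by rw [h1', h2']) hx0' h2).symm
  · by_cases hxx : ht (c x) = ht (c x')
    · exact disjoint_of_same_chains hinj hc hxy hxy' (hinj hxx) (hinj (h2.trans h2'.symm))
        (fun h => hx0 (h ▸ h2)) hdiff
    · have : ht (c x') = -ht (c x) := by
        have := hval (c x); have := hval (c x'); grind
      rw [h2, h2', this]
      exact disjoint_openSegment_of_opposite hx0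

end Drawing

/-- The vertices of a chain in the order of time. -/
lemma exists_chain_enumeration [Fintype V] {ι : Type*} {G : SimpleGraph V} {τ : V → ℕ} {c : V → ι}
    (hc : IsChainPartition G τ c) (i : ι) (hi : ∃ v, c v = i) :
    ∃ (n : ℕ) (e : SimpleGraph.pathGraph (n + 1) ↪g G), StrictMono (fun j => τ (e j)) ∧
      ∀ v, v ∈ Set.range e ↔ c v = i := by
  classical
  let T : Finset ℕ := (Finset.univ.filter fun v => c v = i).image τ
  have hT : T.Nonempty := by
    obtain ⟨v, hv⟩ := hi
    exact ⟨τ v, Finset.mem_image.2 ⟨v, by simp [hv], rfl⟩⟩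
  obtain ⟨n, hn⟩ : ∃ n, T.card = n + 1 := Nat.exists_eq_succ_of_ne_zero hT.card_pos.ne'
  have hex : ∀ j : Fin (n + 1), ∃ v, c v = i ∧ τ v = T.orderEmbOfFin hn j := by
    intro j
    obtain ⟨v, hv, hvj⟩ := Finset.mem_image.1 (T.orderEmbOfFin_mem hn j)
    exact ⟨v, by simpa using hv, hvj⟩
  choose f hf hτf using hex
  have hmono : StrictMono fun j => τ (f j) := fun j j' h => by
    simp only [hτf]
    exact (T.orderEmbOfFin hn).strictMono h
  have hsurj : ∀ v, c v = i → ∃ j, f j = v := by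
    intro v hv
    have h1 : τ v ∈ Set.range (T.orderEmbOfFin hn) := by
      rw [Finset.range_orderEmbOfFin]
      exact Finset.mem_coe.2 (Finset.mem_image.2 ⟨v, by simp [hv], rfl⟩)
    obtain ⟨j, hj⟩ := h1
    exact ⟨j, hc.eq_of_time_eq _ _ ((hf j).trans hv.symm) ((hτf j).trans hj)⟩
  have hnext : ∀ j j', j < j' → ∃ l : Fin (n + 1), l.val = j.val + 1 ∧ Forces G τ (f j) (f l) := by
    intro j j' hjj
    obtain ⟨u, hu, hju, -⟩ := hc.exists_next (f j) (f j') ((hf j).trans (hf j').symm) (hmono hjj)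
    obtain ⟨l, rfl⟩ := hsurj u (hu.trans (hf j))
    refine ⟨l, ?_, hju⟩
    have hjl : j < l := hmono.lt_iff_lt.1 hju.2.1
    by_contra hne
    obtain ⟨u', hu', hju', hle⟩ := hc.exists_next (f j) (f ⟨j.val + 1, by omega⟩)
      ((hf j).trans (hf _).symm) (hmono (by rw [Fin.lt_def]; simp))
    rw [hju'.unique hju] at hle
    have := hmono.le_iff_le.1 hle
    rw [Fin.le_def] at this
    rw [Fin.lt_def] at hjl
    simp only at this
    omega
  -- The path is induced because a vertex forces its successor only when all its other neighbours
  -- are coloured earlier, which excludes chords to later vertices.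
  have hadj : ∀ j j' : Fin (n + 1), j < j' → (G.Adj (f j) (f j') ↔ j.val + 1 = j'.val) := by
    intro j j' hjj
    obtain ⟨l, hl, hjl⟩ := hnext j j' hjj
    constructor
    · intro h
      by_contra hne
      have h1 := hjl.2.2 (f j') h (fun h' => hne (by
        rw [← hl, hmono.injective (congrArg τ h')]))
      have := hmono.lt_iff_lt.1 h1
      rw [Fin.lt_def] at this hjj
      omega
    · intro h
      rw [show j' = l from Fin.ext (by omega)]
      exact hjl.1
  have hf_inj : Function.Injective f := fun a b h => hmono.injective (congrArg τ h)
  refine ⟨n, ⟨⟨f, hf_inj⟩, ?_⟩, hmono, fun v => ?_⟩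
  · intro j j'
    rw [SimpleGraph.pathGraph_adj, Function.Embedding.coeFn_mk]
    rcases lt_trichotomy j j' with h | h | h
    · rw [hadj j j' h]
      rw [Fin.lt_def] at h
      omega
    · subst h
      simp
    · rw [G.adj_comm, hadj j' j h]
      rw [Fin.lt_def] at h
      omega
  · constructor
    · rintro ⟨j, rfl⟩
      exact hf j
    · exact hsurj v

/-- A partition into at most three chains with an unseparated middle chain yields a drawing. -/
lemma nonempty_standardDrawing_of_chains [Fintype V] {G : SimpleGraph V} {τ : V → ℕ} {k : ℕ}
    {c : V → Fin k} {m : Fin k} {ht : Fin k → ℝ} (hinj : Function.Injective ht)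
    (hval : ∀ i, ht i = -1 ∨ ht i = 0 ∨ ht i = 1) (hm0 : ht m = 0)
    (hc : IsChainPartition G τ c) (hsurj : Function.Surjective c) (hm : IsUnseparated G τ c m) :
    Nonempty (StandardDrawing G k) := by
  choose len path hmono hrange using fun i => exists_chain_enumeration hc i (hsurj i)
  have hcp : ∀ i j, c (path i j) = i := fun i j => (hrange i _).1 ⟨j, rfl⟩
  exact ⟨{
    len := len
    path := path
    bijective := by
      constructor
      · rintro ⟨i, j⟩ ⟨i', j'⟩ h
        simp only at h
        obtain rfl : i = i' := by rw [← hcp i j, h, hcp]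
        rw [(path i).injective h]
      · intro v
        obtain ⟨j, hj⟩ := (hrange (c v) v).2 rfl
        exact ⟨⟨c v, j⟩, hj⟩
    pos := fun v => (abscissa G τ c m v, ht (c v))
    height := ht
    height_injective := hinj
    pos_snd := fun i j => congrArg ht (hcp i j)
    pos_fst_strictMono := fun i j j' h =>
      abscissa_lt_abscissa hc ((hcp i j).trans (hcp i j').symm) (hmono i h)
    segment_vertex := fun u v _ hne w hw =>
      segment_vertex_of_chains hinj hval hm0 hc (fun h => hne (congrArg ht h)) hw
    segment_disjoint := fun u v u' v' huv hne huv' hne' hdiff =>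
      segment_disjoint_of_chains hinj hval hm0 hc hm huv huv' hne hne' hdiff }⟩

lemma IsForcingSet.nonempty_standardDrawing [Fintype V] {G : SimpleGraph V} [DecidableRel G.Adj]
    (hG : G.maxDegree ≤ 3) {S : Set V} (hS : IsForcingSet G S) (hS3 : S.ncard ≤ 3)
    [Nonempty V] : Nonempty (StandardDrawing G S.ncard) := by
  obtain ⟨τ, hτS, hτ⟩ := hS.exists_time
  have hk : {w | τ w = 0}.ncard = S.ncard := by
    congr 1
    ext w
    exact hτS w
  have hpos : 0 < S.ncard := by
    obtain ⟨v, hv, -⟩ := exists_start hτ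
    exact (Set.ncard_pos S.toFinite).2 ⟨v, (hτS v).1 hv⟩
  -- With the index `S.ncard / 2` at height 0, one, two or three chains get the heights 0, or -1 and
  -- 0, or -1, 0 and 1.
  obtain ⟨c, hc, hsurj, hm⟩ := exists_isUnseparated hG hτ hk ⟨S.ncard / 2, by omega⟩
  refine nonempty_standardDrawing_of_chains (ht := fun i => ((i.val : ℤ) - (S.ncard / 2 : ℕ) : ℤ))
    ?_ ?_ ?_ hc hsurj hm
  · intro i j h
    have : (i.val : ℤ) - (S.ncard / 2 : ℕ) = (j.val : ℤ) - (S.ncard / 2 : ℕ) := by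
      exact Int.cast_injective (α := ℝ) h
    exact Fin.ext (by omega)
  · intro i
    have : (i.val : ℤ) - (S.ncard / 2 : ℕ) = -1 ∨ (i.val : ℤ) - (S.ncard / 2 : ℕ) = 0 ∨
        (i.val : ℤ) - (S.ncard / 2 : ℕ) = 1 := by
      have := i.2
      omega
    rcases this with h | h | h <;> simp only [h] <;> norm_num
  · simp

/-- In a graph of maximum degree at most three with a standard drawing with three parallel paths
but none with fewer paths, the forcing number is three. -/
lemma IsGraphOfParallelPaths.forcingNumber_eq [Fintype V] {G : SimpleGraph V} [DecidableRel G.Adj]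
    (hG : G.maxDegree ≤ 3) (h : IsGraphOfParallelPaths G 3) : forcingNumber G = 3 := by
  obtain ⟨⟨D⟩, hmin⟩ := h
  have : Nonempty V := ⟨D.path 0 0⟩
  have hle := D.forcingNumber_le le_rfl
  obtain ⟨S, hS, hcard⟩ := exists_isMinForcingSet G
  by_contra hne
  have hD := hS.nonempty_standardDrawing hG (hcard ▸ hle)
  -- A smaller forcing set would give a drawing with fewer than three paths.
  exact not_isEmpty_iff.2 hD (hmin _ (by omega))

lemma isGraphOfParallelPaths_of_forcingNumber_eq [Fintype V] {G : SimpleGraph V}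
    [DecidableRel G.Adj] (hG : G.maxDegree ≤ 3) (h : forcingNumber G = 3) :
    IsGraphOfParallelPaths G 3 := by
  obtain ⟨S, hS, hcard⟩ := exists_isMinForcingSet G
  rw [h] at hcard
  have : Nonempty V := by
    obtain ⟨v, -⟩ := (Set.ncard_pos S.toFinite).1 (by omega : 0 < S.ncard)
    exact ⟨v⟩
  refine ⟨hcard ▸ hS.nonempty_standardDrawing hG hcard.le, fun j hj => ⟨fun D => ?_⟩⟩
  have := D.forcingNumber_le (by omega)
  omega

end ZeroForcing

theorem theorem1 {V : Type*} [Fintype V] (G : SimpleGraph V) [DecidableRel G.Adj]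
    (hG : G.maxDegree ≤ 3) :
    (ZeroForcing.forcingNumber G = 3 ↔ ZeroForcing.IsGraphOfParallelPaths G 3) ∧
    (ZeroForcing.IsGraphOfParallelPaths G 3 →
      ∀ D : ZeroForcing.StandardDrawing G 3, ZeroForcing.IsMinForcingSet G D.leftmost) := by
  refine ⟨⟨ZeroForcing.isGraphOfParallelPaths_of_forcingNumber_eq hG,
    fun h => h.forcingNumber_eq hG⟩, fun h D => ⟨D.isForcingSet_leftmost le_rfl, ?_⟩⟩
  rw [D.ncard_leftmost, h.forcingNumber_eq hG]
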